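/- For integers $m \ge n \ge 1$ let $\Pi_{m,n}$ be the set of real polynomials $\phi$ of degree $m$ with $\phi(x) = e^x + O(x^{n+1})$ as $x \to 0$. For $\phi \in \Pi_{m,n}$ let $R(\phi)$ be the supremum of all $r$ such that $r = 0$, or $r > 0$ and $\phi$ is absolutely monotonic over $[-r,0]$, that is, $\phi^{(k)}(x) \ge 0$ for all $x \in [-r,0]$ and all integers $k \ge 0$. Let $R_{m,n} = \sup\{R(\phi) : \phi \in \Pi_{m,n}\}$ be the optimal threshold factor. Let $L_n^{(\gamma)}(x) = \sum_{k=0}^n (-1)^k \binom{n+\gamma}{n-k} \frac{x^k}{k!}$ denote the generalized Laguerre polynomials, which for $\gamma > -1$ are orthogonal on $[0,\infty)$ with respect to $x^\gamma e^{-x}$. For $R>0$, let $C_n(\cdot,R)$ denote the monic Poisson–Charlier polynomials, which are orthogonal with respect to the measure $\mu_R = e^{-R}\sum_{j\ge 0} \frac{R^j}{j!}\delta_j$ and are given by $C_0(t,R) = 1$, $C_1(t,R) = t - R$ and $C_{n+1}(t,R) = (t - R - n)\,C_n(t,R) - nR\,C_{n-1}(t,R)$ for $n \ge 1$. **Theorem.**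 Let $m$ and $p$ be positive integers with $m \ge 2p-1$. Then the polynomial $L_p^{(m-p)}$ has a smallest real zero $\ell_p^{(m-p)}$, this zero is positive, and $$R_{m,2p-1} \le \ell_p^{(m-p)},$$ with equality if and only if all zeros of the Poisson–Charlier polynomial $C_p(\cdot,\ell_p^{(m-p)})$ are integers. -/

import Mathlib

open Polynomial

noncomputable section

/-- The set `Π_{m,n}` of real polynomials `φ` of degree `m` with
`φ(x) = exp x + O(x^(n+1))` as `x → 0`. -/
def orderPolys (m n : ℕ) : Set ℝ[X] :=
  {φ | φ.degree = (m : WithBot ℕ) ∧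
    (fun x : ℝ => φ.eval x - Real.exp x) =O[nhds 0] (fun x : ℝ => x ^ (n + 1))}

/-- The threshold factor `R(φ)`: the supremum of all `r` such that `r = 0`, or `r > 0` and `φ` is
absolutely monotonic over `[-r, 0]`. The supremum is taken in the extended reals, so that it
carries no convention for unbounded or empty sets. -/
def thresholdFactor (φ : ℝ[X]) : EReal :=
  sSup ((fun r : ℝ => (r : EReal)) '' {r : ℝ | r = 0 ∨
    (0 < r ∧ AbsolutelyMonotoneOn (fun x : ℝ => φ.eval x) (Set.Icc (-r) 0))})

/-- The optimal threshold factor `R_{m,n} = sup {R(φ) | φ ∈ Π_{m,n}}`. -/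
def optimalThresholdFactor (m n : ℕ) : EReal :=
  sSup (thresholdFactor '' orderPolys m n)

/-- The generalized Laguerre polynomial
`L_n^{(γ)}(x) = ∑_{k=0}^n (-1)^k * binom(n + γ, n - k) * x^k / k!`, where
`binom(n + γ, n - k) = (γ + k + 1) ⋯ (γ + n) / (n - k)!`. -/
def laguerrePoly (n : ℕ) (γ : ℝ) : ℝ[X] :=
  ∑ k ∈ Finset.range (n + 1),
    C ((-1) ^ k * ((∏ j ∈ Finset.Ioc k n, (γ + (j : ℝ))) / ((n - k).factorial : ℝ))
      / (k.factorial : ℝ)) * X ^ k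

/-- The monic Poisson–Charlier polynomial `C_n(·, R)`, given by its three-term recurrence
`C_{n+1}(t) = (t - (R + n)) * C_n(t) - n * R * C_{n-1}(t)` with `C_0 = 1` and `C_1 = t - R`. -/
def charlierPoly (R : ℝ) : ℕ → ℝ[X]
  | 0 => 1
  | 1 => X - C R
  | n + 2 => (X - C (R + ((n : ℝ) + 1))) * charlierPoly R (n + 1)
      - C (((n : ℝ) + 1) * R) * charlierPoly R n

end

/-! For `r > 0` put `α_j = r^j φ^(j)(-r) / j!`. A polynomial `φ` of degree `m` is absolutely
monotonic over `[-r, 0]` iff all `α_j ≥ 0`, and it matches `exp` to order `n` iff the factorial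
moments of `α` up to order `n` are the Poisson ones, `r^k`. So the question is for which `r` the
Poisson measure has a nonnegative quadrature on `{0, …, m}` exact in degree `2p - 1`.

By the duality `p! L_p^{(t-p)}(r) = C_p(t, r)`, `ℓ` is the smallest `r` with `C_p(m, r) = 0`. At `r
= ℓ` test with `C_p² / (t - m)`: it is `≤ 0` on `{0, …, m}` and has Poisson mean zero, so `α` lives
on zeros of `C_p`. A threshold beyond `ℓ` would make all `m + 1 > p` weights positive, which gives
the bound.

In case of equality, compactness yields weights at `ℓ` itself; they need at least `p` nodes, which
then exhaust the zeros of `C_p`. Conversely, integer zeros are simple, positive and at most `m`, and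
Gauss quadrature at them supplies the weights. -/

/-! ### Charlier polynomials: difference, shift and derivative relations. -/

theorem charlierPoly_succ (r : ℝ) (n : ℕ) :
    charlierPoly r (n + 1) =
      (X - C (r + n)) * charlierPoly r n - C (n * r) * charlierPoly r (n - 1) := by
  cases n with
  | zero => simp [charlierPoly]
  | succ n => simp [charlierPoly]

theorem charlierPoly_zero (r : ℝ) : charlierPoly r 0 = 1 := rfl

theorem eval_charlierPoly_succ (r : ℝ) (n : ℕ) (t : ℝ) :
    (charlierPoly r (n + 1)).eval t =
      (t - (r + n)) * (charlierPoly r n).eval t - n * r * (charlierPoly r (n - 1)).eval t := by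
  rw [charlierPoly_succ]; simp

theorem charlierPoly_monic_natDegree (r : ℝ) (n : ℕ) :
    (charlierPoly r n).Monic ∧ (charlierPoly r n).natDegree = n := by
  induction n using Nat.strong_induction_on with
  | _ n ih =>
    rcases n with _ | n
    · simp [charlierPoly_zero]
    · obtain ⟨h1, h2⟩ := ih n (by omega)
      have hm : ((X - C (r + n)) * charlierPoly r n).Monic := (monic_X_sub_C _).mul h1
      have hd : ((X - C (r + n)) * charlierPoly r n).natDegree = n + 1 := by
        rw [(monic_X_sub_C _).natDegree_mul h1, natDegree_X_sub_C, h2, add_comm]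
      have hlt : (C (n * r) * charlierPoly r (n - 1)).degree
          < ((X - C (r + n)) * charlierPoly r n).degree := by
        rw [degree_eq_natDegree hm.ne_zero, hd]
        rw [← smul_eq_C_mul]
        refine (degree_smul_le _ _).trans_lt ?_
        obtain ⟨h3, h4⟩ := ih (n - 1) (by omega)
        rw [degree_eq_natDegree h3.ne_zero, h4]
        exact_mod_cast (by omega : n - 1 < n + 1)
      rw [charlierPoly_succ]
      refine ⟨hm.sub_of_left hlt, ?_⟩
      rw [natDegree_eq_of_degree_eq (degree_sub_eq_left_of_degree_lt hlt), hd]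

theorem charlierPoly_monic (r : ℝ) (n : ℕ) : (charlierPoly r n).Monic :=
  (charlierPoly_monic_natDegree r n).1

theorem natDegree_charlierPoly (r : ℝ) (n : ℕ) : (charlierPoly r n).natDegree = n :=
  (charlierPoly_monic_natDegree r n).2

theorem eval_add_one_charlierPoly (r : ℝ) (n : ℕ) (t : ℝ) :
    (charlierPoly r n).eval (t + 1) =
      (charlierPoly r n).eval t + n * (charlierPoly r (n - 1)).eval t := by
  induction n using Nat.strong_induction_on with
  | _ n ih =>
    rcases n with _ | n
    · simp [charlierPoly_zero]
    · rcases n with _ | n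
      · simp [charlierPoly]; ring
      · rw [eval_charlierPoly_succ, ih (n + 1) (by omega), eval_charlierPoly_succ r (n + 1) t]
        simp only [Nat.add_sub_cancel]
        rw [ih n (by omega), eval_charlierPoly_succ r n t]
        push_cast
        ring

/-- The raising relation; its operator is adjoint to the forward difference (times `r`) under the
Poisson mean. -/
theorem eval_charlierPoly_succ_eq_shift (r : ℝ) (n : ℕ) (t : ℝ) :
    (charlierPoly r (n + 1)).eval t =
      t * (charlierPoly r n).eval (t - 1) - r * (charlierPoly r n).eval t := by
  induction n with
  | zero => simp [charlierPoly]
  | succ n ih =>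
    have h := eval_add_one_charlierPoly r (n + 1) (t - 1)
    rw [sub_add_cancel] at h
    rw [eval_charlierPoly_succ r (n + 1) t]
    simp only [Nat.add_sub_cancel] at h ⊢
    push_cast at h ⊢
    linear_combination t * h - ((n : ℝ) + 1) * ih

theorem charlierPoly_succ_eq_shift (r : ℝ) (n : ℕ) :
    charlierPoly r (n + 1) =
      X * (charlierPoly r n).comp (X - 1) - C r * charlierPoly r n := by
  refine Polynomial.funext fun t => ?_
  rw [eval_charlierPoly_succ_eq_shift]
  simp

theorem hasDerivAt_eval_charlierPoly (n : ℕ) (t r : ℝ) :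
    HasDerivAt (fun r => (charlierPoly r n).eval t) (-(n * (charlierPoly r (n - 1)).eval t)) r := by
  induction n using Nat.strong_induction_on with
  | _ n ih =>
    rcases n with _ | n
    · simpa [charlierPoly_zero] using hasDerivAt_const r (1 : ℝ)
    · have h1 := ih n (by omega)
      have h2 := ih (n - 1) (by omega)
      have h3 : HasDerivAt (fun r : ℝ => t - (r + n)) (-1) r := by
        simpa using ((hasDerivAt_id r).add_const (n : ℝ)).const_sub t
      have h4 : HasDerivAt (fun r : ℝ => (n : ℝ) * r) n r := by
        simpa using (hasDerivAt_id r).const_mul (n : ℝ)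
      have h5 := (h3.mul h1).sub (h4.mul h2)
      refine (h5.congr_of_eventuallyEq (Filter.Eventually.of_forall fun s => ?_)).congr_deriv ?_
      · simp [eval_charlierPoly_succ]
      · rcases n with _ | n
        · simp [charlierPoly_zero]
        · simp only [Nat.add_sub_cancel]
          rw [eval_charlierPoly_succ r n t]
          push_cast
          ring

/-! ### The Poisson mean and orthogonality. -/

/-- Induction on the degree: in `f = X * divX f + c` the factor `j` cancels against `j!`, and the
index shift leaves a polynomial of lower degree. -/
theorem summable_poisson_eval (r : ℝ) (f : ℝ[X]) :
    Summable fun j : ℕ => r ^ j / (j.factorial : ℝ) * f.eval (j : ℝ) := by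
  induction hn : f.natDegree using Nat.strong_induction_on generalizing f with
  | _ n ih =>
    have hexp : Summable fun j : ℕ => r ^ j / (j.factorial : ℝ) := Real.summable_pow_div_factorial r
    rcases Nat.eq_zero_or_pos n with h0 | hpos
    · rw [eq_C_of_natDegree_eq_zero (hn.trans h0)]
      simpa using hexp.mul_right (f.coeff 0)
    · have hg : Summable fun j : ℕ => r ^ j / (j.factorial : ℝ) * (j * f.divX.eval (j : ℝ)) := by
        rw [← summable_nat_add_iff 1]
        have hd : (taylor 1 f.divX).natDegree < n := by
          rw [natDegree_taylor, natDegree_divX_eq_natDegree_tsub_one]; omega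
        refine ((ih _ hd _ rfl).mul_left r).congr fun j => ?_
        rw [taylor_eval, Nat.factorial_succ]
        push_cast
        have : (j : ℝ) + 1 ≠ 0 := by positivity
        field_simp
        ring
      refine (hg.add (hexp.mul_right (f.coeff 0))).congr fun j => ?_
      conv_rhs => rw [← divX_mul_X_add f]
      simp
      ring

/-- The mean of a polynomial with respect to the Poisson distribution with parameter `r`. -/
noncomputable def poissonMean (r : ℝ) : ℝ[X] →ₗ[ℝ] ℝ where
  toFun f := Real.exp (-r) * ∑' j : ℕ, r ^ j / (j.factorial : ℝ) * f.eval (j : ℝ)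
  map_add' f g := by
    simp only [eval_add, mul_add]
    rw [(summable_poisson_eval r f).tsum_add (summable_poisson_eval r g), mul_add]
  map_smul' c f := by
    simp only [eval_smul, smul_eq_mul, RingHom.id_apply, mul_left_comm _ c]
    rw [tsum_mul_left]
    ring

theorem poissonMean_apply (r : ℝ) (f : ℝ[X]) : poissonMean r f =
    Real.exp (-r) * ∑' j : ℕ, r ^ j / (j.factorial : ℝ) * f.eval (j : ℝ) := rfl

theorem poissonMean_one (r : ℝ) : poissonMean r 1 = 1 := by
  have h : ∑' j : ℕ, r ^ j / (j.factorial : ℝ) = Real.exp r := by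
    rw [Real.exp_eq_exp_ℝ, NormedSpace.exp_eq_tsum_div]
  rw [poissonMean_apply]
  simp [h, ← Real.exp_add]

theorem poissonMean_X_mul (r : ℝ) (f : ℝ[X]) :
    poissonMean r (X * f) = r * poissonMean r (taylor 1 f) := by
  rw [poissonMean_apply, poissonMean_apply, (summable_poisson_eval r (X * f)).tsum_eq_zero_add,
    mul_left_comm, ← tsum_mul_left (a := r)]
  simp only [eval_mul, eval_X, Nat.cast_zero, zero_mul, mul_zero, zero_add]
  congr 1
  refine tsum_congr fun j => ?_
  rw [taylor_eval, Nat.factorial_succ]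
  push_cast
  have : (j : ℝ) + 1 ≠ 0 := by positivity
  field_simp
  ring

theorem poissonMean_pos {r : ℝ} (hr : 0 < r) {f : ℝ[X]} (hf : f ≠ 0)
    (hnn : ∀ j : ℕ, 0 ≤ f.eval (j : ℝ)) : 0 < poissonMean r f := by
  obtain ⟨j, hj⟩ : ∃ j : ℕ, f.eval (j : ℝ) ≠ 0 := by
    by_contra! h
    refine hf (eq_zero_of_infinite_isRoot f ?_)
    exact (Set.infinite_range_of_injective (Nat.cast_injective (R := ℝ))).mono
      (by rintro _ ⟨j, rfl⟩; exact h j)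
  rw [poissonMean_apply]
  refine mul_pos (Real.exp_pos _) ((summable_poisson_eval r f).tsum_pos (fun i => ?_) j ?_)
  · exact mul_nonneg (by positivity) (hnn i)
  · exact mul_pos (by positivity) (lt_of_le_of_ne (hnn j) hj.symm)

theorem poissonMean_sq_pos {r : ℝ} (hr : 0 < r) {f : ℝ[X]} (hf : f ≠ 0) :
    0 < poissonMean r (f ^ 2) :=
  poissonMean_pos hr (pow_ne_zero 2 hf) fun j => by rw [eval_pow]; positivity

theorem taylor_one_comp_X_sub_one (f : ℝ[X]) : taylor 1 (f.comp (X - 1)) = f := by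
  rw [taylor_apply, comp_assoc]; simp

theorem poissonMean_descPochhammer (r : ℝ) (k : ℕ) :
    poissonMean r (descPochhammer ℝ k) = r ^ k := by
  induction k with
  | zero => simp [poissonMean_one]
  | succ k ih =>
    rw [descPochhammer_succ_left, poissonMean_X_mul, taylor_one_comp_X_sub_one, ih, pow_succ']

theorem degree_taylor_sub_self_lt {g : ℝ[X]} {p : ℕ} (hg : g.degree < (p + 1 : ℕ)) (a : ℝ) :
    (taylor a g - g).degree < p := by
  rcases eq_or_ne g 0 with rfl | h0
  · simp
  have h := degree_sub_lt_left (degree_taylor g a) ((taylor_eq_zero a g).not.mpr h0)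
    (leadingCoeff_taylor (f := g) (r := a))
  rw [degree_taylor] at h
  refine h.trans_le ?_
  rw [degree_eq_natDegree h0] at hg ⊢
  exact_mod_cast Nat.lt_succ_iff.mp (by exact_mod_cast hg)

/-- The raising relation and `poissonMean_X_mul` turn the mean of `C_{p+1} g` into `r` times the
mean of `C_p (g(· + 1) - g)`, and the difference lowers the degree of `g`. -/
theorem poissonMean_charlierPoly_mul (r : ℝ) (p : ℕ) {g : ℝ[X]} (hg : g.degree < p) :
    poissonMean r (charlierPoly r p * g) = 0 := by
  induction p generalizing g with
  | zero =>
    have : g = 0 := by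
      rw [← degree_eq_bot]; exact Nat.WithBot.lt_zero_iff.mp (by exact_mod_cast hg)
    simp [this]
  | succ p ih =>
    have h1 : charlierPoly r (p + 1) * g =
        X * ((charlierPoly r p).comp (X - 1) * g) - r • (charlierPoly r p * g) := by
      rw [charlierPoly_succ_eq_shift, smul_eq_C_mul]; ring
    have h2 := ih (degree_taylor_sub_self_lt hg 1)
    rw [mul_sub, map_sub, sub_eq_zero] at h2
    rw [h1, map_sub, map_smul, poissonMean_X_mul, taylor_mul, taylor_one_comp_X_sub_one, h2,
      smul_eq_mul, sub_self]

theorem linearMap_eq_of_eq_descPochhammer {L M : ℝ[X] →ₗ[ℝ] ℝ} {N : ℕ}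
    (h : ∀ k < N, L (descPochhammer ℝ k) = M (descPochhammer ℝ k)) {f : ℝ[X]}
    (hf : f.degree < N) : L f = M f := by
  induction N generalizing f with
  | zero =>
    have : f = 0 := by
      rw [← degree_eq_bot]; exact Nat.WithBot.lt_zero_iff.mp (by exact_mod_cast hf)
    simp [this]
  | succ N ih =>
    have hd : (f - C (f.coeff N) * descPochhammer ℝ N).degree < N := by
      rw [degree_lt_iff_coeff_zero]
      intro k hk
      rw [coeff_sub, coeff_C_mul]
      rcases hk.eq_or_lt with rfl | hk
      · have : (descPochhammer ℝ N).coeff N = 1 := by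
          have h1 := monic_descPochhammer ℝ N
          rwa [Monic, leadingCoeff, descPochhammer_natDegree] at h1
        simp [this]
      · rw [coeff_eq_zero_of_degree_lt (hf.trans_le (by exact_mod_cast hk)),
          coeff_eq_zero_of_natDegree_lt (p := descPochhammer ℝ N) (by rwa [descPochhammer_natDegree])]
        simp
    have h1 := ih (fun k hk => h k (by omega)) hd
    rw [← smul_eq_C_mul, map_sub, map_sub, map_smul, map_smul, h N (by omega)] at h1
    linarith

/-! ### Duality of Laguerre and Charlier polynomials. -/

theorem mul_descPochhammer_eval_sub_one (n : ℕ) (t : ℝ) :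
    t * (descPochhammer ℝ n).eval (t - 1) = (descPochhammer ℝ (n + 1)).eval t := by
  rw [descPochhammer_succ_left]; simp

theorem eval_charlierPoly_eq_sum (r : ℝ) (p : ℕ) (t : ℝ) :
    (charlierPoly r p).eval t = ∑ ij ∈ Finset.HasAntidiagonal.antidiagonal p,
      (p.choose ij.1 : ℝ) * ((-r) ^ ij.1 * (descPochhammer ℝ ij.2).eval t) := by
  induction p generalizing t with
  | zero => simp [charlierPoly_zero]
  | succ p ih =>
    rw [eval_charlierPoly_succ_eq_shift, ih, ih,
      Finset.sum_antidiagonal_choose_succ_mul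
        (fun i j => (-r) ^ i * (descPochhammer ℝ j).eval t), Finset.mul_sum, Finset.mul_sum,
      sub_eq_add_neg, ← Finset.sum_neg_distrib]
    congr 1
    · refine Finset.sum_congr rfl fun ij _ => ?_
      rw [← mul_descPochhammer_eval_sub_one]
      ring
    · refine Finset.sum_congr rfl fun ij hij => ?_
      rw [← Finset.HasAntidiagonal.mem_antidiagonal.mp hij, Nat.choose_symm_add]
      ring

theorem prod_Ioc_add_cast (γ : ℝ) (k q : ℕ) :
    ∏ j ∈ Finset.Ioc k (k + q), (γ + (j : ℝ)) = (descPochhammer ℝ q).eval (γ + (k + q)) := by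
  induction q with
  | zero => simp
  | succ q ih =>
    rw [← add_assoc, Finset.prod_Ioc_succ_top (by omega), ih, ← mul_descPochhammer_eval_sub_one]
    push_cast
    rw [mul_comm]
    congr 2 <;> ring

/-- With `γ = t - p` the product in each Laguerre coefficient is a falling factorial of `t`, so the
two expansions agree term by term. -/
theorem eval_laguerrePoly_mul_factorial (p : ℕ) (t r : ℝ) :
    (laguerrePoly p (t - p)).eval r * p.factorial = (charlierPoly r p).eval t := by
  rw [eval_charlierPoly_eq_sum, laguerrePoly, eval_finsetSum, Finset.sum_mul,
    Finset.Nat.sum_antidiagonal_eq_sum_range_succ_mk]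
  refine Finset.sum_congr rfl fun k hk => ?_
  have hk : k ≤ p := by simpa [Nat.lt_succ_iff] using hk
  obtain ⟨q, rfl⟩ := Nat.exists_eq_add_of_le hk
  have h1 : ((k + q).choose k : ℝ) * k.factorial * q.factorial = (k + q).factorial := by
    have := Nat.choose_mul_factorial_mul_factorial hk
    rw [Nat.add_sub_cancel_left] at this
    exact_mod_cast this
  have h2 := prod_Ioc_add_cast (t - ((k + q : ℕ) : ℝ)) k q
  rw [show t - ((k + q : ℕ) : ℝ) + (k + q) = t by push_cast; ring] at h2
  rw [h2]
  simp only [eval_mul, eval_C, eval_pow, eval_X, Nat.add_sub_cancel_left]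
  have h3 : (k.factorial : ℝ) ≠ 0 := by positivity
  have h4 : (q.factorial : ℝ) ≠ 0 := by positivity
  rw [← h1, neg_pow r]
  field_simp

/-! ### Sign of `C_p(t, r)` and the smallest Laguerre zero. -/

theorem eval_charlierPoly_pos_of_nonpos {r : ℝ} (hr : r ≤ 0) (p : ℕ) {t : ℝ}
    (ht : (p : ℝ) < t + 1) : 0 < (charlierPoly r p).eval t := by
  induction p generalizing t with
  | zero => simp [charlierPoly_zero]
  | succ p ih =>
    rw [eval_charlierPoly_succ_eq_shift]
    push_cast at ht
    have h0 : (0 : ℝ) ≤ p := p.cast_nonneg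
    have h1 := ih (t := t) (by linarith)
    have h2 := ih (t := t - 1) (by linarith)
    have h3 : 0 < t * (charlierPoly r p).eval (t - 1) := mul_pos (by linarith) h2
    have h4 : r * (charlierPoly r p).eval t ≤ 0 := mul_nonpos_of_nonpos_of_nonneg hr h1.le
    linarith

theorem continuous_eval_charlierPoly (p : ℕ) (t : ℝ) :
    Continuous fun r => (charlierPoly r p).eval t :=
  continuous_iff_continuousAt.mpr fun r => (hasDerivAt_eval_charlierPoly p t r).continuousAt

theorem hasDerivAt_pow_mul_charlierPoly (d q : ℕ) {t : ℝ} (ht : t = d + 1 + q) (r : ℝ) :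
    HasDerivAt (fun r => r ^ (d + 1) * (charlierPoly r q).eval t)
      (t * r ^ d * (charlierPoly r q).eval (t - 1)) r := by
  refine ((hasDerivAt_pow (d + 1) r).mul (hasDerivAt_eval_charlierPoly q t r)).congr_deriv ?_
  have h1 := eval_charlierPoly_succ_eq_shift r q t
  have h2 := eval_charlierPoly_succ r q t
  simp only [Nat.add_sub_cancel]
  push_cast
  rw [h2] at h1
  have h3 : (d : ℝ) = t - 1 - q := by linarith
  rw [h3]
  linear_combination r ^ d * h1

/-- Rodrigues and Rolle: `exp(-r) r^(d+1) C_q(t, r)` has derivative `exp(-r) r^d C_{q+1}(t, r)`.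
Without a zero it would increase strictly from `0` at `r = 0`, yet it tends to `0` at infinity. -/
theorem exists_eval_charlierPoly_eq_zero (d q : ℕ) {t : ℝ} (ht : t = d + 1 + q) :
    ∃ r, (charlierPoly r (q + 1)).eval t = 0 := by
  by_contra! hne
  have hpos : ∀ r, 0 < (charlierPoly r (q + 1)).eval t := by
    intro r
    by_contra! hr
    have h0 : 0 < (charlierPoly 0 (q + 1)).eval t :=
      eval_charlierPoly_pos_of_nonpos le_rfl _ (by rw [ht]; push_cast; linarith [d.cast_nonneg (α := ℝ)])
    obtain ⟨s, hs⟩ := mem_range_of_exists_le_of_exists_ge (continuous_eval_charlierPoly (q + 1) t)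
      ⟨r, hr⟩ ⟨0, h0.le⟩
    exact hne s hs
  set G : ℝ → ℝ := fun r => Real.exp (-r) * (r ^ (d + 1) * (charlierPoly r q).eval t) with hG
  have hder : ∀ r, HasDerivAt G (Real.exp (-r) * (r ^ d * (charlierPoly r (q + 1)).eval t)) r := by
    intro r
    have h1 : HasDerivAt (fun r : ℝ => Real.exp (-r)) (Real.exp (-r) * -1) r :=
      (hasDerivAt_neg r).exp
    refine (h1.mul (hasDerivAt_pow_mul_charlierPoly d q ht r)).congr_deriv ?_
    rw [eval_charlierPoly_succ_eq_shift]
    ring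
  have hmono : StrictMonoOn G (Set.Ici 0) := by
    refine strictMonoOn_of_deriv_pos (convex_Ici 0)
      (fun r _ => (hder r).continuousAt.continuousWithinAt) fun r hr => ?_
    rw [interior_Ici, Set.mem_Ioi] at hr
    rw [(hder r).deriv]
    have := hpos r
    positivity
  have hG0 : G 0 = 0 := by simp [hG]
  have hG1 : 0 < G 1 := by
    rw [← hG0]; exact hmono (by simp) (by simp) one_pos
  have hlim : Filter.Tendsto G Filter.atTop (nhds 0) := by
    -- Duality exhibits `C_q(t, r)` as a polynomial in `r`.
    refine (tendsto_div_exp_atTop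
      (X ^ (d + 1) * (laguerrePoly q (t - q) * C (q.factorial : ℝ)))).congr fun r => ?_
    simp only [hG, eval_mul, eval_pow, eval_X, eval_C, eval_laguerrePoly_mul_factorial]
    rw [Real.exp_neg, div_eq_inv_mul]
  have hge : ∀ᶠ r in Filter.atTop, G 1 ≤ G r := by
    filter_upwards [Filter.eventually_ge_atTop (1 : ℝ)] with r hr
    exact hmono.monotoneOn (by simp) (by simp; linarith) hr
  exact hG1.not_ge (ge_of_tendsto hlim hge)

theorem laguerrePoly_eval_eq_zero_iff (p : ℕ) (t r : ℝ) :
    (laguerrePoly p (t - p)).eval r = 0 ↔ (charlierPoly r p).eval t = 0 := by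
  rw [← eval_laguerrePoly_mul_factorial, mul_eq_zero_iff_right (by positivity)]

/-- The Laguerre polynomial `L_p^{(m-p)}` has a smallest real zero, and it is positive. -/
theorem exists_isLeast_laguerrePoly_zero {m p : ℕ} (hp : 1 ≤ p) (hpm : p ≤ m) :
    ∃ ℓ : ℝ, IsLeast {x : ℝ | (laguerrePoly p ((m : ℝ) - (p : ℝ))).eval x = 0} ℓ ∧ 0 < ℓ := by
  obtain ⟨q, rfl⟩ := Nat.exists_eq_add_of_le' hp
  obtain ⟨d, rfl⟩ := Nat.exists_eq_add_of_le' hpm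
  set L := laguerrePoly (q + 1) (((d + (q + 1) : ℕ) : ℝ) - ((q + 1 : ℕ) : ℝ)) with hL
  have hpos : ∀ x ≤ 0, L.eval x ≠ 0 := by
    intro x hx h
    rw [hL, laguerrePoly_eval_eq_zero_iff] at h
    refine (eval_charlierPoly_pos_of_nonpos hx _ ?_).ne' h
    push_cast
    linarith [d.cast_nonneg (α := ℝ)]
  have h0 : L ≠ 0 := fun h => hpos 0 le_rfl (by simp [h])
  have hfin : {x : ℝ | L.eval x = 0}.Finite := finite_setOfPred_isRoot h0
  have hne : {x : ℝ | L.eval x = 0}.Nonempty := by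
    obtain ⟨r, hr⟩ := exists_eval_charlierPoly_eq_zero d q
      (t := ((d + (q + 1) : ℕ) : ℝ)) (by push_cast; ring)
    exact ⟨r, (laguerrePoly_eval_eq_zero_iff _ _ _).mpr hr⟩
  obtain ⟨ℓ, hℓ⟩ := hfin.isCompact.exists_isLeast hne
  exact ⟨ℓ, hℓ, lt_of_not_ge fun h => hpos ℓ h hℓ.1⟩

theorem eval_charlierPoly_pos_of_lt_least {m p : ℕ} (hpm : p ≤ m) {ℓ : ℝ}
    (hℓ : IsLeast {x : ℝ | (laguerrePoly p ((m : ℝ) - (p : ℝ))).eval x = 0} ℓ) {r : ℝ}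
    (hr : r < ℓ) : 0 < (charlierPoly r p).eval (m : ℝ) := by
  by_contra! hneg
  have h0 : 0 < (charlierPoly 0 p).eval (m : ℝ) :=
    eval_charlierPoly_pos_of_nonpos le_rfl _ (by exact_mod_cast Nat.lt_succ_of_le hpm)
  have hr0 : 0 ≤ r := by
    by_contra! h
    exact hneg.not_gt
      (eval_charlierPoly_pos_of_nonpos h.le _ (by exact_mod_cast Nat.lt_succ_of_le hpm))
  obtain ⟨s, hs, hs0⟩ := intermediate_value_Icc' hr0
    (continuous_eval_charlierPoly p (m : ℝ)).continuousOn ⟨hneg, h0.le⟩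
  have := hℓ.2 ((laguerrePoly_eval_eq_zero_iff p m s).mpr hs0)
  linarith [hs.2]

/-- Confines the natural zeros of `C_p(·, ℓ)` to `{0, …, m}`. A power of `r` times `C_p(j + 1, r)`
vanishes at `r = 0`, and its derivative is a positive multiple of `C_p(j, r)`. -/
theorem eval_charlierPoly_pos_of_lt {m p : ℕ} (hpm : p ≤ m) {ℓ : ℝ} (hℓ0 : 0 < ℓ)
    (hℓ : IsLeast {x : ℝ | (laguerrePoly p ((m : ℝ) - (p : ℝ))).eval x = 0} ℓ) {j : ℕ}
    (hj : m < j) : 0 < (charlierPoly ℓ p).eval (j : ℝ) := by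
  -- The induction needs all `r < ℓ`, since the derivative is used on the open interval below `r`;
  -- the endpoint `ℓ` is admitted only past `m`.
  suffices h : ∀ k : ℕ, ∀ r, 0 < r → r < ℓ ∨ (0 < k ∧ r = ℓ) →
      0 < (charlierPoly r p).eval ((m + k : ℕ) : ℝ) by
    obtain ⟨k, rfl⟩ := Nat.exists_eq_add_of_lt hj
    exact h (k + 1) ℓ hℓ0 (Or.inr ⟨by omega, rfl⟩)
  intro k
  induction k with
  | zero =>
    intro r _ hr
    exact eval_charlierPoly_pos_of_lt_least hpm hℓ (by simpa using hr)
  | succ k ih =>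
    intro r hr0 hr
    have hrl : r ≤ ℓ := by rcases hr with h | h; exacts [h.le, h.2.le]
    have ht : ((m + (k + 1) : ℕ) : ℝ) = (m + k - p : ℕ) + 1 + p := by
      rw [Nat.cast_sub (by omega)]; push_cast; ring
    have hder := hasDerivAt_pow_mul_charlierPoly (m + k - p) p ht
    have hmono : StrictMonoOn (fun r => r ^ (m + k - p + 1) *
        (charlierPoly r p).eval ((m + (k + 1) : ℕ) : ℝ)) (Set.Icc 0 r) := by
      refine strictMonoOn_of_deriv_pos (convex_Icc 0 r)
        (fun s _ => (hder s).continuousAt.continuousWithinAt) fun s hs => ?_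
      rw [interior_Icc] at hs
      rw [(hder s).deriv]
      have h1 := ih s hs.1 (Or.inl (hs.2.trans_le hrl))
      rw [show ((m + (k + 1) : ℕ) : ℝ) - 1 = ((m + k : ℕ) : ℝ) by push_cast; ring]
      have := hs.1
      positivity
    have h2 := hmono (Set.left_mem_Icc.mpr hr0.le) (Set.right_mem_Icc.mpr hr0.le) hr0
    simp only [ne_eq, Nat.succ_ne_zero, not_false_eq_true, zero_pow, zero_mul] at h2
    exact pos_of_mul_pos_right h2 (by positivity)

/-! ### Absolute monotonicity and order via Taylor coefficients. -/

theorem coeff_taylor_eq_sum (f : ℝ[X]) (a : ℝ) (k : ℕ) {N : ℕ} (hN : f.natDegree ≤ N) :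
    (taylor a f).coeff k = ∑ j ∈ Finset.range (N + 1), f.coeff j * (a ^ (j - k) * (j.choose k : ℝ)) := by
  conv_lhs => rw [f.as_sum_range_C_mul_X_pow' (Nat.lt_succ_of_le hN)]
  rw [map_sum, finsetSum_coeff]
  refine Finset.sum_congr rfl fun j _ => ?_
  rw [taylor_mul, taylor_C, taylor_X_pow, coeff_C_mul, coeff_X_add_C_pow]

theorem taylor_coeff_nonneg {f : ℝ[X]} {a : ℝ} (ha : 0 ≤ a) (hf : ∀ k, 0 ≤ f.coeff k) (k : ℕ) :
    0 ≤ (taylor a f).coeff k := by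
  rw [coeff_taylor_eq_sum f a k le_rfl]
  exact Finset.sum_nonneg fun j _ => mul_nonneg (hf j) (by positivity)

theorem taylor_coeff_pos {f : ℝ[X]} {a : ℝ} (ha : 0 < a) (hf : ∀ k, 0 ≤ f.coeff k) (h0 : f ≠ 0)
    {k : ℕ} (hk : k ≤ f.natDegree) : 0 < (taylor a f).coeff k := by
  rw [coeff_taylor_eq_sum f a k le_rfl]
  refine Finset.sum_pos' (fun j _ => mul_nonneg (hf j) (by positivity))
    ⟨f.natDegree, by simp, mul_pos ?_ ?_⟩
  · exact lt_of_le_of_ne (hf _) (leadingCoeff_ne_zero.mpr h0).symm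
  · have := Nat.choose_pos hk
    positivity

theorem iteratedDeriv_eval_eq_taylor (φ : ℝ[X]) (k : ℕ) (x : ℝ) :
    iteratedDeriv k (fun x => φ.eval x) x = (k.factorial : ℝ) * (taylor x φ).coeff k := by
  have h : ∀ k, iteratedDeriv k (fun x => φ.eval x) = fun x => (derivative^[k] φ).eval x := by
    intro k
    induction k with
    | zero => simp
    | succ k ih =>
      rw [iteratedDeriv_succ, ih]
      ext x
      rw [Polynomial.deriv, Function.iterate_succ_apply']
  rw [h, taylor_coeff, ← factorial_smul_hasseDeriv]
  simp

/-- The left endpoint decides: recentring to the right preserves nonnegative coefficients. -/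
theorem absolutelyMonotoneOn_Icc_iff (φ : ℝ[X]) {r : ℝ} (hr : 0 < r) :
    AbsolutelyMonotoneOn (fun x : ℝ => φ.eval x) (Set.Icc (-r) 0) ↔
      ∀ k, 0 ≤ (taylor (-r) φ).coeff k := by
  have hcd : ∀ n, ContDiff ℝ n (fun x : ℝ => φ.eval x) := fun n => by
    simpa using φ.contDiff_aeval (𝕜 := ℝ) n
  constructor
  · intro h k
    have hmem : -r ∈ Set.Icc (-r) 0 := Set.left_mem_Icc.mpr (by linarith)
    have hu : UniqueDiffOn ℝ (Set.Icc (-r) 0) := uniqueDiffOn_Icc (by linarith)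
    have h1 := h.iteratedDerivWithin_nonneg hu k hmem
    rw [iteratedDerivWithin_eq_iteratedDeriv hu (hcd _).contDiffAt hmem,
      iteratedDeriv_eval_eq_taylor] at h1
    exact nonneg_of_mul_nonneg_right h1 (by positivity)
  · intro h
    refine AbsolutelyMonotoneOn.of_contDiff (hcd _) fun k x hx => ?_
    rw [iteratedDeriv_eval_eq_taylor]
    have h1 : taylor x φ = taylor (x + r) (taylor (-r) φ) := by
      rw [taylor_taylor]; congr 2; ring
    rw [h1]
    exact mul_nonneg (by positivity) (taylor_coeff_nonneg (by linarith [hx.1]) h k)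

theorem X_pow_dvd_of_isBigO {P : ℝ[X]} {n : ℕ}
    (h : (fun x : ℝ => P.eval x) =O[nhds 0] (fun x : ℝ => x ^ n)) : X ^ n ∣ P := by
  induction n with
  | zero => simp
  | succ n ih =>
    have h1 : (fun x : ℝ => x ^ (n + 1)) =O[nhds 0] (fun x : ℝ => x ^ n) := by
      have := (Asymptotics.isBigO_refl (fun x : ℝ => x ^ n) (nhds 0)).mul
        ((continuous_id.tendsto (0 : ℝ)).isBigO_one ℝ)
      simpa [pow_succ] using this
    obtain ⟨Q, rfl⟩ := ih (h.trans h1)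
    obtain ⟨c, hc⟩ := h.bound
    have hQ : Q.eval 0 = 0 := by
      have ht : Filter.Tendsto (fun x => Q.eval x) (nhdsWithin 0 {0}ᶜ) (nhds (Q.eval 0)) :=
        Q.continuous.continuousAt.continuousWithinAt
      refine tendsto_nhds_unique ht ?_
      refine squeeze_zero_norm' (a := fun x => c * ‖x‖) ?_ ?_
      · filter_upwards [nhdsWithin_le_nhds hc, self_mem_nhdsWithin] with x hx hx0
        have hx0 : 0 < ‖x‖ := norm_pos_iff.mpr hx0
        simp only [eval_mul, eval_pow, eval_X, norm_mul, norm_pow] at hx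
        have hp : 0 < ‖x‖ ^ n := by positivity
        refine le_of_mul_le_mul_left ?_ hp
        rw [pow_succ] at hx
        linarith
      · have : Filter.Tendsto (fun x : ℝ => c * ‖x‖) (nhds 0) (nhds (c * ‖(0 : ℝ)‖)) :=
          (by fun_prop : Continuous fun x : ℝ => c * ‖x‖).tendsto 0
        simp only [norm_zero, mul_zero] at this
        exact this.mono_left nhdsWithin_le_nhds
    rw [pow_succ]
    exact mul_dvd_mul_left _ (X_dvd_iff.mpr (by rwa [coeff_zero_eq_eval_zero]))

theorem isBigO_of_X_pow_dvd {P : ℝ[X]} {n : ℕ} (h : X ^ n ∣ P) :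
    (fun x : ℝ => P.eval x) =O[nhds 0] (fun x : ℝ => x ^ n) := by
  obtain ⟨Q, rfl⟩ := h
  have := (Asymptotics.isBigO_refl (fun x : ℝ => x ^ n) (nhds 0)).mul
    ((Q.continuous.tendsto (0 : ℝ)).isBigO_one ℝ)
  simpa using this

theorem mem_orderPolys_iff {m n : ℕ} {φ : ℝ[X]} : φ ∈ orderPolys m n ↔
    φ.degree = (m : WithBot ℕ) ∧ ∀ k ≤ n, φ.coeff k = 1 / (k.factorial : ℝ) := by
  refine and_congr_right fun _ => ?_
  set T : ℝ[X] := ∑ i ∈ Finset.range (n + 1), C (1 / (i.factorial : ℝ)) * X ^ i with hT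
  have hexp : (fun x : ℝ => Real.exp x - T.eval x) =O[nhds 0] (fun x : ℝ => x ^ (n + 1)) := by
    refine (Real.exp_sub_sum_range_isBigO_pow (n + 1)).congr_left fun x => ?_
    rw [hT, eval_finsetSum]
    congr 1
    refine Finset.sum_congr rfl fun i _ => ?_
    simp
    ring
  have hTc : ∀ k ≤ n, T.coeff k = 1 / (k.factorial : ℝ) := by
    intro k hk
    simp [hT, coeff_X_pow, hk]
  have hdvd : X ^ (n + 1) ∣ φ - T ↔ ∀ k ≤ n, φ.coeff k = 1 / (k.factorial : ℝ) := by
    rw [X_pow_dvd_iff]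
    refine forall_congr' fun k => ?_
    rw [Nat.lt_succ_iff]
    refine forall_congr' fun hk => ?_
    rw [coeff_sub, hTc k hk, sub_eq_zero]
  rw [← hdvd]
  constructor
  · intro h
    refine X_pow_dvd_of_isBigO ((h.add hexp).congr_left fun x => ?_)
    simp
  · intro h
    refine ((isBigO_of_X_pow_dvd h).sub hexp).congr_left fun x => ?_
    simp

/-! ### The dictionary between polynomials and Poisson weights. -/

/-- Nonnegative weights on `{0, …, m}` whose factorial moments of order at most `N` are those of
the Poisson distribution with parameter `r`. -/
def IsPoissonWeight (m N : ℕ) (r : ℝ) (α : ℕ → ℝ) : Prop :=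
  (∀ j, 0 ≤ α j) ∧ ∀ k ≤ N,
    ∑ j ∈ Finset.range (m + 1), α j * (descPochhammer ℝ k).eval (j : ℝ) = r ^ k

theorem pow_mul_descPochhammer_eval {r : ℝ} (j k : ℕ) :
    r ^ j * (descPochhammer ℝ k).eval (j : ℝ) =
      r ^ k * (k.factorial : ℝ) * (r ^ (j - k) * (j.choose k : ℝ)) := by
  rw [descPochhammer_eval_eq_descFactorial, Nat.descFactorial_eq_factorial_mul_choose]
  push_cast
  rcases le_or_gt k j with h | h
  · rw [← Nat.add_sub_cancel' h, pow_add, Nat.add_sub_cancel_left]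
    ring
  · simp [Nat.choose_eq_zero_of_lt h]

theorem sum_taylor_coeff_mul_descPochhammer {f : ℝ[X]} {m : ℕ} (hf : f.natDegree ≤ m) (r : ℝ)
    (k : ℕ) : ∑ j ∈ Finset.range (m + 1), f.coeff j * r ^ j * (descPochhammer ℝ k).eval (j : ℝ) =
      r ^ k * (k.factorial : ℝ) * (taylor r f).coeff k := by
  rw [coeff_taylor_eq_sum f r k hf, Finset.mul_sum]
  refine Finset.sum_congr rfl fun j _ => ?_
  rw [mul_assoc, pow_mul_descPochhammer_eval]
  ring

theorem isPoissonWeight_of_mem_orderPolys {m N : ℕ} {φ : ℝ[X]} (hφ : φ ∈ orderPolys m N) {r : ℝ}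
    (hr : 0 ≤ r) (h : ∀ k, 0 ≤ (taylor (-r) φ).coeff k) :
    IsPoissonWeight m N r fun j => (taylor (-r) φ).coeff j * r ^ j := by
  obtain ⟨hd, hc⟩ := mem_orderPolys_iff.mp hφ
  refine ⟨fun j => mul_nonneg (h j) (by positivity), fun k hk => ?_⟩
  rw [sum_taylor_coeff_mul_descPochhammer
    (by rw [natDegree_taylor, natDegree_eq_of_degree_eq_some hd]), taylor_taylor, add_neg_cancel,
    taylor_zero, hc k hk]
  have : (k.factorial : ℝ) ≠ 0 := by positivity
  field_simp

theorem exists_mem_orderPolys_of_isPoissonWeight {m N : ℕ} {r : ℝ} (hr : 0 < r) {α : ℕ → ℝ}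
    (hα : IsPoissonWeight m N r α) (hm : α m ≠ 0) :
    ∃ φ ∈ orderPolys m N, AbsolutelyMonotoneOn (fun x : ℝ => φ.eval x) (Set.Icc (-r) 0) := by
  set f : ℝ[X] := ∑ j ∈ Finset.range (m + 1), C (α j / r ^ j) * X ^ j with hf
  have hc : ∀ j, f.coeff j = if j < m + 1 then α j / r ^ j else 0 := by
    intro j
    simp [hf, coeff_X_pow]
  have hd : f.degree = (m : WithBot ℕ) := by
    refine le_antisymm ?_ (le_degree_of_ne_zero ?_)
    · rw [degree_le_iff_coeff_zero]
      intro j hj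
      rw [hc, if_neg]
      have : m < j := by exact_mod_cast hj
      omega
    · rw [hc, if_pos (Nat.lt_succ_self m)]
      positivity
  refine ⟨taylor r f, mem_orderPolys_iff.mpr ⟨by rw [degree_taylor, hd], fun k hk => ?_⟩, ?_⟩
  · have h1 := sum_taylor_coeff_mul_descPochhammer (natDegree_eq_of_degree_eq_some hd).le r k
    rw [Finset.sum_congr rfl (g := fun j : ℕ => α j * (descPochhammer ℝ k).eval (j : ℝ)),
      hα.2 k hk] at h1
    · have h2 : r ^ k ≠ 0 := by positivity
      rw [mul_assoc] at h1
      have h3 := mul_left_cancel₀ h2 ((mul_one _).trans h1)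
      rw [eq_div_iff (by positivity), mul_comm, ← h3]
    · intro j hj
      rw [hc, if_pos (Finset.mem_range.mp hj), div_mul_cancel₀ _ (by positivity)]
  · rw [absolutelyMonotoneOn_Icc_iff _ hr, taylor_taylor, neg_add_cancel, taylor_zero]
    intro k
    rw [hc]
    split_ifs
    · exact div_nonneg (hα.1 k) (by positivity)
    · exact le_rfl

/-! ### Support of the weights and the upper bound. -/

theorem IsPoissonWeight.sum_eq_poissonMean {m N : ℕ} {r : ℝ} {α : ℕ → ℝ}
    (hα : IsPoissonWeight m N r α) {f : ℝ[X]} (hf : f.degree < (N + 1 : ℕ)) :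
    ∑ j ∈ Finset.range (m + 1), α j * f.eval (j : ℝ) = poissonMean r f := by
  have h := linearMap_eq_of_eq_descPochhammer
    (L := ∑ j ∈ Finset.range (m + 1), α j • leval (j : ℝ)) (M := poissonMean r) (N := N + 1)
    (fun k hk => ?_) hf
  · simpa [LinearMap.sum_apply] using h
  · rw [poissonMean_descPochhammer, ← hα.2 k (Nat.lt_succ_iff.mp hk)]
    simp [LinearMap.sum_apply]

theorem charlierPoly_factor {r z : ℝ} {p : ℕ} (hz : (charlierPoly r p).eval z = 0) :
    ∃ q : ℝ[X], charlierPoly r p = (X - C z) * q ∧ q ≠ 0 ∧ q.natDegree + 1 = p := by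
  obtain ⟨q, hq⟩ := dvd_iff_isRoot.mpr hz
  have h0 : charlierPoly r p ≠ 0 := (charlierPoly_monic r p).ne_zero
  have hq0 : q ≠ 0 := by rintro rfl; exact h0 (by simpa using hq)
  refine ⟨q, hq, hq0, ?_⟩
  have := congrArg natDegree hq
  rw [natDegree_charlierPoly, natDegree_mul (X_sub_C_ne_zero z) hq0, natDegree_X_sub_C] at this
  omega

/-- Write `C_p = (X - m) q`. Then `C_p q = (X - m) q²` has degree `2p - 1`, just within exactness;
its mean is zero by orthogonality and no term of the sum is positive, so every term vanishes. -/
theorem IsPoissonWeight.eval_charlierPoly_eq_zero {m p : ℕ} (hp : 1 ≤ p) {r : ℝ} {α : ℕ → ℝ}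
    (hα : IsPoissonWeight m (2 * p - 1) r α) (hm : (charlierPoly r p).eval (m : ℝ) = 0) {j : ℕ}
    (hj : j ≤ m) (hαj : α j ≠ 0) : (charlierPoly r p).eval (j : ℝ) = 0 := by
  obtain ⟨q, hq, hq0, hqd⟩ := charlierPoly_factor hm
  have hqdeg : q.degree < p := by
    rw [degree_eq_natDegree hq0]; exact_mod_cast (by omega : q.natDegree < p)
  have hdeg : (charlierPoly r p * q).degree < ((2 * p - 1 + 1 : ℕ) : WithBot ℕ) := by
    rw [degree_mul, degree_eq_natDegree (charlierPoly_monic r p).ne_zero,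
      degree_eq_natDegree hq0, natDegree_charlierPoly]
    exact_mod_cast (by omega : p + q.natDegree < 2 * p - 1 + 1)
  have hsum := hα.sum_eq_poissonMean hdeg
  rw [poissonMean_charlierPoly_mul r p hqdeg] at hsum
  have hterm : ∀ i ∈ Finset.range (m + 1), α i * (charlierPoly r p * q).eval (i : ℝ) ≤ 0 := by
    intro i hi
    refine mul_nonpos_of_nonneg_of_nonpos (hα.1 i) ?_
    have him : (i : ℝ) ≤ m := by exact_mod_cast Nat.lt_succ_iff.mp (Finset.mem_range.mp hi)
    rw [hq, mul_assoc]
    simp only [eval_mul, eval_sub, eval_X, eval_C]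
    exact mul_nonpos_of_nonpos_of_nonneg (by linarith) (mul_self_nonneg _)
  have h1 := (Finset.sum_eq_zero_iff_of_nonpos hterm).mp hsum j
    (Finset.mem_range.mpr (Nat.lt_succ_of_le hj))
  have h2 := (mul_eq_zero.mp h1).resolve_left hαj
  rw [eval_mul, mul_eq_zero] at h2
  rcases h2 with h2 | h2
  · exact h2
  · rw [hq, eval_mul, h2, mul_zero]

theorem card_le_of_eval_charlierPoly_eq_zero {r : ℝ} {p : ℕ} {S : Finset ℕ}
    (hS : ∀ j ∈ S, (charlierPoly r p).eval (j : ℝ) = 0) : S.card ≤ p := by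
  by_contra! h
  refine (charlierPoly_monic r p).ne_zero
    (eq_zero_of_natDegree_lt_card_of_eval_eq_zero' _ (S.image (Nat.cast : ℕ → ℝ)) ?_ ?_)
  · simpa using hS
  · rwa [natDegree_charlierPoly, Finset.card_image_of_injective _ Nat.cast_injective]

theorem thresholdFactor_le {m p : ℕ} (hp : 1 ≤ p) (hmp : 2 * p - 1 ≤ m) {ℓ : ℝ} (hℓ : 0 < ℓ)
    (hm : (charlierPoly ℓ p).eval (m : ℝ) = 0) {φ : ℝ[X]} (hφ : φ ∈ orderPolys m (2 * p - 1)) :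
    thresholdFactor φ ≤ ℓ := by
  refine sSup_le ?_
  rintro _ ⟨r, hr | ⟨hr, hmono⟩, rfl⟩
  · exact EReal.coe_le_coe_iff.mpr (hr.le.trans hℓ.le)
  refine EReal.coe_le_coe_iff.mpr ?_
  by_contra! hlt
  rw [absolutelyMonotoneOn_Icc_iff φ hr] at hmono
  have ht : taylor (-ℓ) φ = taylor (r - ℓ) (taylor (-r) φ) := by
    rw [taylor_taylor]; congr 2; ring
  have hd : φ.degree = m := hφ.1
  have hφ0 : φ ≠ 0 := by rintro rfl; simp at hd
  have hnn : ∀ k, 0 ≤ (taylor (-ℓ) φ).coeff k := by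
    rw [ht]; exact taylor_coeff_nonneg (by linarith) hmono
  -- Recentring strictly to the right, from `-r` to `-ℓ`, adds a positive contribution of the
  -- leading coefficient to every lower one.
  have hpos : ∀ k ≤ m, 0 < (taylor (-ℓ) φ).coeff k := by
    intro k hk
    rw [ht]
    refine taylor_coeff_pos (by linarith) hmono ((taylor_eq_zero _ _).not.mpr hφ0) ?_
    rwa [natDegree_taylor, natDegree_eq_of_degree_eq_some hd]
  have hcard := card_le_of_eval_charlierPoly_eq_zero (r := ℓ) (p := p)
    (S := Finset.range (m + 1)) fun j hj => by
      have hj := Nat.lt_succ_iff.mp (Finset.mem_range.mp hj)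
      exact (isPoissonWeight_of_mem_orderPolys hφ hℓ.le hnn).eval_charlierPoly_eq_zero hp hm
        hj (mul_pos (hpos j hj) (by positivity)).ne'
  rw [Finset.card_range] at hcard
  omega

/-! ### Equality forces integer zeros. -/

theorem exists_isPoissonWeight_of_lt_optimal {m N : ℕ} {r : ℝ} (hr : 0 < r)
    (h : (r : EReal) < optimalThresholdFactor m N) : ∃ α, IsPoissonWeight m N r α := by
  obtain ⟨_, ⟨φ, hφ, rfl⟩, h1⟩ := lt_sSup_iff.mp h
  obtain ⟨_, ⟨s, hs, rfl⟩, h2⟩ := lt_sSup_iff.mp h1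
  have hrs : r < s := EReal.coe_lt_coe_iff.mp h2
  rcases hs with hs | ⟨hs, hmono⟩
  · linarith
  rw [absolutelyMonotoneOn_Icc_iff φ hs] at hmono
  refine ⟨_, isPoissonWeight_of_mem_orderPolys hφ hr.le ?_⟩
  have ht : taylor (-r) φ = taylor (s - r) (taylor (-s) φ) := by
    rw [taylor_taylor]; congr 2; ring
  rw [ht]
  exact taylor_coeff_nonneg (by linarith) hmono

theorem exists_isPoissonWeight_of_forall_lt {m N : ℕ} {ℓ : ℝ} (hℓ : 0 < ℓ)
    (h : ∀ r, 0 < r → r < ℓ → ∃ α, IsPoissonWeight m N r α) : ∃ α, IsPoissonWeight m N ℓ α := by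
  -- The zeroth moment puts the weights in the simplex, so the admissible pairs `(r, α)` form a
  -- compact set, whose projection to `r` is closed.
  set F : Set (ℝ × (Fin (m + 1) → ℝ)) := (Set.Icc 0 ℓ ×ˢ stdSimplex ℝ (Fin (m + 1))) ∩
    ⋂ k ∈ Set.Iic N, {x | ∑ j, x.2 j * (descPochhammer ℝ k).eval ((j : ℕ) : ℝ) = x.1 ^ k} with hF
  have hcF : IsCompact F := by
    refine (isCompact_Icc.prod (isCompact_stdSimplex ℝ _)).inter_right ?_
    refine isClosed_biInter fun k _ => isClosed_eq ?_ ?_ <;> fun_prop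
  have hcl : IsClosed (Prod.fst '' F) := (hcF.image continuous_fst).isClosed
  have hsub : Set.Ioo 0 ℓ ⊆ Prod.fst '' F := by
    intro r hr
    obtain ⟨α, hα⟩ := h r hr.1 hr.2
    refine ⟨(r, fun j => α j), ⟨⟨Set.Ioo_subset_Icc_self hr, fun j => hα.1 j, ?_⟩, ?_⟩, rfl⟩
    · have := hα.2 0 (Nat.zero_le _)
      rw [Finset.sum_range] at this
      simpa using this
    · simp only [Set.mem_iInter, Set.mem_Iic]
      intro k hk
      have := hα.2 k hk
      rw [Finset.sum_range] at this
      exact this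
  have hmem : ℓ ∈ Prod.fst '' F := by
    refine hcl.closure_subset_iff.mpr hsub ?_
    rw [closure_Ioo hℓ.ne]
    exact Set.right_mem_Icc.mpr hℓ.le
  obtain ⟨⟨r, a⟩, ⟨⟨_, ha, _⟩, hk⟩, rfl⟩ := hmem
  refine ⟨fun j => if hj : j < m + 1 then a ⟨j, hj⟩ else 0, fun j => ?_, fun k hkN => ?_⟩
  · dsimp only
    split_ifs
    exacts [ha _, le_rfl]
  · simp only [Set.mem_iInter, Set.mem_Iic] at hk
    rw [Finset.sum_range, ← hk k hkN]
    exact Finset.sum_congr rfl fun j _ => by simp [Fin.is_le]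

/-- With fewer than `p` nodes the squared nodal polynomial has degree at most `2p - 2`, quadrature
sum zero and positive mean. -/
theorem IsPoissonWeight.le_card_support {m p : ℕ} {r : ℝ} (hr : 0 < r) {α : ℕ → ℝ}
    (hα : IsPoissonWeight m (2 * p - 1) r α) :
    p ≤ ((Finset.range (m + 1)).filter fun j => α j ≠ 0).card := by
  set S := (Finset.range (m + 1)).filter fun j => α j ≠ 0 with hS
  by_contra! hlt
  set Q : ℝ[X] := ∏ j ∈ S, (X - C (j : ℝ)) with hQ
  have hQm : Q.Monic := monic_prod_X_sub_C _ _
  have hdeg : (Q ^ 2).degree < ((2 * p - 1 + 1 : ℕ) : WithBot ℕ) := by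
    rw [degree_eq_natDegree (hQm.pow 2).ne_zero, natDegree_pow, hQ, natDegree_finsetProd_X_sub_C_eq_card]
    exact_mod_cast (by omega : 2 * S.card < 2 * p - 1 + 1)
  have h1 := hα.sum_eq_poissonMean hdeg
  have h2 := poissonMean_sq_pos hr hQm.ne_zero
  rw [← h1, Finset.sum_eq_zero] at h2
  · exact lt_irrefl _ h2
  intro j hj
  by_cases hj0 : α j = 0
  · simp [hj0]
  · have : Q.eval (j : ℝ) = 0 := by
      rw [hQ, eval_prod]
      exact Finset.prod_eq_zero (Finset.mem_filter.mpr ⟨hj, hj0⟩) (by simp)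
    simp [this]

theorem exists_int_of_aeval_charlierPoly_eq_zero {r : ℝ} {p : ℕ} {S : Finset ℕ} (hS : p ≤ S.card)
    (hz : ∀ j ∈ S, (charlierPoly r p).eval (j : ℝ) = 0) {z : ℂ}
    (hz0 : aeval z (charlierPoly r p) = 0) : ∃ k : ℤ, z = (k : ℂ) := by
  by_contra! hne
  have hm : ((charlierPoly r p).map (algebraMap ℝ ℂ)).Monic := (charlierPoly_monic r p).map _
  refine hm.ne_zero (eq_zero_of_natDegree_lt_card_of_eval_eq_zero' _
    (insert z (S.image (Nat.cast : ℕ → ℂ))) ?_ ?_)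
  · intro w hw
    rcases Finset.mem_insert.mp hw with rfl | hw
    · rwa [eval_map_algebraMap]
    · obtain ⟨j, hj, rfl⟩ := Finset.mem_image.mp hw
      have := congrArg (algebraMap ℝ ℂ) (hz j hj)
      rw [← eval_map_apply] at this
      simpa using this
  · rw [Finset.card_insert_of_notMem, Finset.card_image_of_injective _ Nat.cast_injective,
      natDegree_map, natDegree_charlierPoly]
    · omega
    · intro hw
      obtain ⟨j, hj, rfl⟩ := Finset.mem_image.mp hw
      exact hne j (by simp)

/-! ### Gauss quadrature at integer zeros. -/

/-- Divide by `C_p`: the quotient has degree below `p`, so orthogonality removes its part, and the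
remainder is its own interpolant at the nodes. -/
theorem poissonMean_eq_sum_of_zeros {r : ℝ} {p : ℕ} {S : Finset ℕ} (hS : S.card = p)
    (hz : ∀ j ∈ S, (charlierPoly r p).eval (j : ℝ) = 0) {f : ℝ[X]}
    (hf : f.degree < (2 * p : ℕ)) : poissonMean r f =
      ∑ j ∈ S, f.eval (j : ℝ) * poissonMean r (Lagrange.basis S (Nat.cast : ℕ → ℝ) j) := by
  have hm := charlierPoly_monic r p
  have hdiv := modByMonic_add_div f (charlierPoly r p)
  have hq : (f /ₘ charlierPoly r p).degree < p := by
    rcases eq_or_ne (f /ₘ charlierPoly r p) 0 with h | h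
    · rw [h]; simp
    have hf0 : f ≠ 0 := by rintro rfl; simp at h
    have h2 := natDegree_divByMonic f hm
    rw [natDegree_charlierPoly] at h2
    rw [degree_eq_natDegree h]
    rw [degree_eq_natDegree hf0] at hf
    have hf' : f.natDegree < 2 * p := by exact_mod_cast hf
    have h3 : 0 < p := by omega
    exact_mod_cast (by omega : (f /ₘ charlierPoly r p).natDegree < p)
  have hrem : f %ₘ charlierPoly r p =
      Lagrange.interpolate S (Nat.cast : ℕ → ℝ) fun j => f.eval (j : ℝ) := by
    refine Lagrange.eq_interpolate_of_eval_eq _ Nat.cast_injective.injOn ?_ fun j hj => ?_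
    · rw [hS]
      refine (degree_modByMonic_lt f hm).trans_le ?_
      rw [degree_eq_natDegree hm.ne_zero, natDegree_charlierPoly]
    · conv_rhs => rw [← hdiv]
      simp [hz j hj]
  conv_lhs => rw [← hdiv, map_add, poissonMean_charlierPoly_mul r p hq, add_zero, hrem]
  rw [Lagrange.interpolate_apply, map_sum]
  refine Finset.sum_congr rfl fun j _ => ?_
  rw [← smul_eq_C_mul, map_smul, smul_eq_mul]

/-- Exactness on the squared basis polynomial shows that the weight is the mean of that square. -/
theorem poissonMean_basis_pos {r : ℝ} (hr : 0 < r) {p : ℕ} {S : Finset ℕ} (hS : S.card = p)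
    (hz : ∀ j ∈ S, (charlierPoly r p).eval (j : ℝ) = 0) {j : ℕ} (hj : j ∈ S) :
    0 < poissonMean r (Lagrange.basis S (Nat.cast : ℕ → ℝ) j) := by
  have hinj : Set.InjOn (Nat.cast : ℕ → ℝ) S := Nat.cast_injective.injOn
  have hb0 := Lagrange.basis_ne_zero hinj hj
  have hcard : 0 < S.card := Finset.card_pos.mpr ⟨j, hj⟩
  have h := poissonMean_eq_sum_of_zeros hS hz
    (f := Lagrange.basis S (Nat.cast : ℕ → ℝ) j ^ 2) (by
      rw [degree_pow, Lagrange.degree_basis hinj hj, nsmul_eq_mul]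
      exact_mod_cast (by omega : 2 * (S.card - 1) < 2 * p))
  rw [Finset.sum_eq_single_of_mem j hj fun i hi hij => by
    rw [eval_pow, Lagrange.eval_basis_of_ne hij.symm hi]; simp, eval_pow,
    Lagrange.eval_basis_self hinj hj, one_pow, one_mul] at h
  rw [← h]
  exact poissonMean_sq_pos hr hb0

theorem isPoissonWeight_of_zeros {r : ℝ} (hr : 0 < r) {m p : ℕ} (hp : 1 ≤ p) {S : Finset ℕ}
    (hS : S.card = p) (hz : ∀ j ∈ S, (charlierPoly r p).eval (j : ℝ) = 0)
    (hSm : S ⊆ Finset.range (m + 1)) : IsPoissonWeight m (2 * p - 1) r fun j =>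
      if j ∈ S then poissonMean r (Lagrange.basis S (Nat.cast : ℕ → ℝ) j) else 0 := by
  refine ⟨fun j => ?_, fun k hk => ?_⟩
  · dsimp only
    split_ifs with hj
    exacts [(poissonMean_basis_pos hr hS hz hj).le, le_rfl]
  · rw [← poissonMean_descPochhammer, poissonMean_eq_sum_of_zeros hS hz]
    · simp only [ite_mul, zero_mul]
      rw [Finset.sum_ite_mem, Finset.inter_eq_right.mpr hSm]
      exact Finset.sum_congr rfl fun j _ => mul_comm _ _
    · rw [degree_eq_natDegree (monic_descPochhammer ℝ k).ne_zero, descPochhammer_natDegree]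
      exact_mod_cast (by omega : k < 2 * p)

/-- For `C_p = (X - z) q`, orthogonality to `q` gives that `z` times the mean of `q²` equals the
mean of `X q²`, which is positive. -/
theorem charlierPoly_zero_pos {r : ℝ} (hr : 0 < r) {p : ℕ} {z : ℝ}
    (hz : (charlierPoly r p).eval z = 0) : 0 < z := by
  obtain ⟨q, hq, hq0, hqd⟩ := charlierPoly_factor hz
  have h1 := poissonMean_charlierPoly_mul r p (g := q) (by
    rw [degree_eq_natDegree hq0]; exact_mod_cast (by omega : q.natDegree < p))
  have h2 : charlierPoly r p * q = X * q ^ 2 - z • q ^ 2 := by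
    rw [hq, smul_eq_C_mul]; ring
  rw [h2, map_sub, map_smul, poissonMean_X_mul, taylor_pow, smul_eq_mul] at h1
  have h3 := poissonMean_sq_pos hr hq0
  have h4 := mul_pos hr (poissonMean_sq_pos hr ((taylor_eq_zero 1 q).not.mpr hq0))
  exact pos_of_mul_pos_left (by linarith) h3.le

/-- If `C_p = (X - z)² q`, then `C_p q` is a nonzero square, contradicting orthogonality to `q`. -/
theorem charlierPoly_zero_simple {r : ℝ} (hr : 0 < r) {p : ℕ} {z : ℝ}
    (hz : (charlierPoly r p).eval z = 0) : (derivative (charlierPoly r p)).eval z ≠ 0 := by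
  intro hz'
  have h0 := (charlierPoly_monic r p).ne_zero
  have h1 := (le_rootMultiplicity_iff h0).mp
    ((one_lt_rootMultiplicity_iff_isRoot h0).mpr ⟨hz, hz'⟩)
  obtain ⟨q, hq⟩ := h1
  have hq0 : q ≠ 0 := by rintro rfl; exact h0 (by simpa using hq)
  have hd := congrArg natDegree hq
  rw [natDegree_charlierPoly, natDegree_mul (pow_ne_zero _ (X_sub_C_ne_zero z)) hq0,
    natDegree_pow, natDegree_X_sub_C] at hd
  have h2 := poissonMean_charlierPoly_mul r p (g := q) (by
    rw [degree_eq_natDegree hq0]; exact_mod_cast (by omega : q.natDegree < p))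
  rw [hq, show (X - C z) ^ (1 + 1) * q * q = ((X - C z) * q) ^ 2 by ring] at h2
  exact (poissonMean_sq_pos hr (mul_ne_zero (X_sub_C_ne_zero z) hq0)).ne' h2

theorem eval_map_intCast_eq_zero_iff (f : ℝ[X]) (k : ℤ) :
    (f.map (algebraMap ℝ ℂ)).eval (k : ℂ) = 0 ↔ f.eval (k : ℝ) = 0 := by
  have : (k : ℂ) = algebraMap ℝ ℂ k := by simp
  rw [this, eval_map_apply, map_eq_zero]

theorem le_card_nat_zeros {r : ℝ} (hr : 0 < r) {m p : ℕ}
    (hm : ∀ j : ℕ, m < j → (charlierPoly r p).eval (j : ℝ) ≠ 0)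
    (hint : ∀ z : ℂ, aeval z (charlierPoly r p) = 0 → ∃ k : ℤ, z = (k : ℂ)) :
    p ≤ ((Finset.range (m + 1)).filter fun j : ℕ => (charlierPoly r p).eval (j : ℝ) = 0).card := by
  classical
  set P := (charlierPoly r p).map (algebraMap ℝ ℂ) with hP
  have hP0 : P ≠ 0 := ((charlierPoly_monic r p).map _).ne_zero
  have hint' : ∀ z : ℂ, P.eval z = 0 → ∃ k : ℤ, z = (k : ℂ) ∧
      (charlierPoly r p).eval (k : ℝ) = 0 := by
    intro z hz
    obtain ⟨k, rfl⟩ := hint z (by rwa [hP, eval_map_algebraMap] at hz)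
    exact ⟨k, rfl, (eval_map_intCast_eq_zero_iff _ _).mp hz⟩
  have hnodup : P.roots.Nodup := by
    rw [Multiset.nodup_iff_count_le_one]
    intro z
    rw [count_roots]
    by_contra! h
    obtain ⟨h1, h2⟩ := (one_lt_rootMultiplicity_iff_isRoot hP0).mp h
    obtain ⟨k, rfl, hk⟩ := hint' z h1
    rw [hP, derivative_map] at h2
    exact charlierPoly_zero_simple hr hk ((eval_map_intCast_eq_zero_iff _ _).mp h2)
  have hcard : P.roots.toFinset.card = p := by
    rw [Multiset.toFinset_card_of_nodup hnodup,
      IsAlgClosed.card_roots_eq_natDegree, hP, natDegree_map, natDegree_charlierPoly]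
  refine hcard.ge.trans ?_
  refine (Finset.card_le_card ?_).trans (Finset.card_image_le (f := (Nat.cast : ℕ → ℂ)))
  intro z hz
  rw [Multiset.mem_toFinset, mem_roots hP0] at hz
  obtain ⟨k, rfl, hk⟩ := hint' z hz
  have hk0 : 0 < k := by exact_mod_cast charlierPoly_zero_pos hr hk
  obtain ⟨j, rfl⟩ := Int.eq_ofNat_of_zero_le hk0.le
  rw [Int.cast_natCast] at hk
  refine Finset.mem_image.mpr ⟨j, Finset.mem_filter.mpr ⟨?_, hk⟩, by simp⟩
  by_contra h
  exact hm j (by simpa [Nat.lt_succ_iff] using h) hk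

/-! ### The main theorem. -/

theorem theorem1 (m p : ℕ) (hm : 1 ≤ m) (hp : 1 ≤ p) (hmp : 2 * p - 1 ≤ m) :
    ∃ ℓ : ℝ, IsLeast {x : ℝ | (laguerrePoly p ((m : ℝ) - (p : ℝ))).eval x = 0} ℓ ∧ 0 < ℓ ∧
      optimalThresholdFactor m (2 * p - 1) ≤ (ℓ : EReal) ∧
      (optimalThresholdFactor m (2 * p - 1) = (ℓ : EReal) ↔
        ∀ z : ℂ, Polynomial.aeval z (charlierPoly ℓ p) = 0 → ∃ k : ℤ, z = (k : ℂ)) := by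
  have hpm : p ≤ m := by omega
  obtain ⟨ℓ, hleast, hℓ⟩ := exists_isLeast_laguerrePoly_zero hp hpm
  have hzero : (charlierPoly ℓ p).eval (m : ℝ) = 0 :=
    (laguerrePoly_eval_eq_zero_iff p m ℓ).mp hleast.1
  have hle : optimalThresholdFactor m (2 * p - 1) ≤ (ℓ : EReal) := by
    refine sSup_le ?_
    rintro _ ⟨φ, hφ, rfl⟩
    exact thresholdFactor_le hp hmp hℓ hzero hφ
  refine ⟨ℓ, hleast, hℓ, hle, fun heq z hz => ?_, fun hint => le_antisymm hle ?_⟩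
  · obtain ⟨α, hα⟩ := exists_isPoissonWeight_of_forall_lt hℓ fun r hr hrl =>
      exists_isPoissonWeight_of_lt_optimal (m := m) (N := 2 * p - 1) hr
        (by rw [heq]; exact_mod_cast hrl)
    refine exists_int_of_aeval_charlierPoly_eq_zero (hα.le_card_support hℓ) (fun j hj => ?_) hz
    obtain ⟨hj, hj0⟩ := Finset.mem_filter.mp hj
    exact hα.eval_charlierPoly_eq_zero hp hzero (Nat.lt_succ_iff.mp (Finset.mem_range.mp hj)) hj0
  · set S := (Finset.range (m + 1)).filter fun j : ℕ => (charlierPoly ℓ p).eval (j : ℝ) = 0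
    have hz : ∀ j ∈ S, (charlierPoly ℓ p).eval (j : ℝ) = 0 := fun j hj =>
      (Finset.mem_filter.mp hj).2
    have hS : S.card = p := le_antisymm (card_le_of_eval_charlierPoly_eq_zero hz)
      (le_card_nat_zeros hℓ
        (fun j hj => (eval_charlierPoly_pos_of_lt hpm hℓ hleast hj).ne') hint)
    -- The node `m` carries a positive weight, so the resulting polynomial has degree exactly `m`.
    have hmS : m ∈ S := Finset.mem_filter.mpr ⟨Finset.self_mem_range_succ m, hzero⟩
    obtain ⟨φ, hφ, hmono⟩ := exists_mem_orderPolys_of_isPoissonWeight hℓ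
      (isPoissonWeight_of_zeros hℓ hp hS hz (Finset.filter_subset _ _))
      (by simpa [hmS] using (poissonMean_basis_pos hℓ hS hz hmS).ne')
    exact (le_sSup ⟨ℓ, Or.inr ⟨hℓ, hmono⟩, rfl⟩ : (ℓ : EReal) ≤ thresholdFactor φ).trans
      (le_sSup ⟨φ, hφ, rfl⟩)
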